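/- Game $\mathcal M_6$. Let $1\le K<N$ be integers and $R,c>0$. There are $N$ users; their types $q_1,\dots,q_N$ are independent with the uniform distribution on $[0,1]$, and each user knows only her own type. A user of type $q$ chooses a contribution $x\in[0,q]$ and pays the cost $c\,x/q$ (cost $0$ for type $q=0$, whose only choice is $x=0$). Among the users with a positive contribution, the $K$ largest contributions receive a reward $R/K$ each (ties are broken uniformly at random, and a user who contributes $0$ receives nothing). A user's utility is her expected reward minus her cost. A measurable strategy $b:[0,1]\to\mathbb R$ with $0\le b(q)\le q$ is a symmetric equilibrium if, whenever all other users follow $b$, for every type $q\in[0,1]$ the contribution $b(q)$ maximizes the expected utility of a user of type $q$ over all contributions in $[0,q]$. Let $F$ be the distribution function of the uniform distribution on $[0,1]$ and, for $x\in[0,1]$, $$\beta(x)=\frac{R(N-1)}{cK}\binom{N-2}{K-1}\int_0^x t\,F(t)^{N-K-1}(1-F(t))^{K-1}\,\mathrm dF(t).$$ Theorem. Suppose that the equation $\beta(x)=x$ has two solutions $x_1<x_2$ in $(0,1]$. Then there is exactly one point $x_p\in(x_1,1]$ with $\beta'(x_p)=1$, and the function $$\beta^*(x)=\begin{cases}\beta(x),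 & x\in[0,x_1],\\ x, & x\in(x_1,x_p],\\ \beta(x)-\beta(x_p)+x_p, & x\in(x_p,1],\end{cases}$$ is a symmetric equilibrium. -/

import Mathlib

open MeasureTheory Set

/-- Probability that user `i` is one of the (at most) `K` rewarded users when the contribution
profile is `x`. A user who contributes nothing does not participate and is never rewarded. The
rewarded users are the participants with the `K` largest contributions; ties at the last
rewarded places are broken uniformly at random: the `K - #{j | x i < x j}` places that are left
(truncated at `0`) are shared among the `#{j | x j = x i}` users tied with `i`
(`i` itself included). -/
noncomputable def topKShare {N : ℕ} (K : ℕ) (x : Fin N → ℝ) (i : Fin N) : ℝ :=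
  if 0 < x i then
    min 1 (((K - (Finset.univ.filter fun j => x i < x j).card : ℕ) : ℝ) /
      ((Finset.univ.filter fun j => x j = x i).card : ℝ))
  else 0

/-- Top-`K` allocation: every rewarded user receives `R / K`. -/
noncomputable def topKReward {N : ℕ} (K : ℕ) (R : ℝ) (x : Fin N → ℝ) (i : Fin N) : ℝ :=
  R / K * topKShare K x i

/-- Interim expected utility of user `i` of type `t` who contributes `a`, when the types of the
users are independent with law `μ` and every other user `j` of type `q j` contributes
`σ j (q j)`. The profile is overwritten by `a` at `i`, so `q i` and `σ i` play no role.
The cost of the contribution is `c * (a / t)`; type `0` can only contribute `a = 0`, at cost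
`0`. -/
noncomputable def interimUtility {N : ℕ} (K : ℕ) (R c : ℝ) (μ : Measure ℝ)
    (σ : Fin N → ℝ → ℝ) (i : Fin N) (a t : ℝ) : ℝ :=
  (∫ q : Fin N → ℝ, topKReward K R (Function.update (fun j => σ j (q j)) i a) i
    ∂(Measure.pi fun _ : Fin N => μ)) - c * (a / t)

/-- Pure-strategy (Bayesian) Nash equilibrium of the partial-information game with top-`K`
allocation and the continuous action space `[0, t]` for type `t ∈ [0, 1]`:
strategies are measurable and feasible, and for every user and every type the prescribed
contribution maximises the interim expected utility over all feasible contributions. -/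
structure IsPureNashEquilibrium {N : ℕ} (K : ℕ) (R c : ℝ) (μ : Measure ℝ)
    (σ : Fin N → ℝ → ℝ) : Prop where
  measurable : ∀ i, Measurable (σ i)
  feasible : ∀ i, ∀ t ∈ Icc (0 : ℝ) 1, σ i t ∈ Icc 0 t
  optimal : ∀ i, ∀ t ∈ Icc (0 : ℝ) 1, ∀ a ∈ Icc 0 t,
    interimUtility K R c μ σ i a t ≤ interimUtility K R c μ σ i (σ i t) t

/-- A strategy `b` is a symmetric equilibrium (of the game with `N` users) if it is an
equilibrium that all users follow `b`. -/
def IsSymmetricEquilibrium (N K : ℕ) (R c : ℝ) (μ : Measure ℝ) (b : ℝ → ℝ) : Prop :=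
  IsPureNashEquilibrium K R c μ (fun _ : Fin N => b)

/-- The uncalibrated strategy, with `F` the distribution function of `μ`:
`β(x) = R(N-1)/(cK) * C(N-2, K-1) * ∫_[0,x] t F(t)^(N-K-1) (1-F(t))^(K-1) dF(t)`. -/
noncomputable def uncalibrated (N K : ℕ) (R c : ℝ) (μ : Measure ℝ) (x : ℝ) : ℝ :=
  R * ((N : ℝ) - 1) / (c * K) * ((N - 2).choose (K - 1) : ℝ) *
    ∫ t in Icc 0 x, t * ProbabilityTheory.cdf μ t ^ (N - K - 1) *
      (1 - ProbabilityTheory.cdf μ t) ^ (K - 1) ∂μ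

/-- The uniform distribution over `[0, 1]`. -/
noncomputable def uniform01 : Measure ℝ := volume.restrict (Icc 0 1)

/-- The calibration of `b` at `x₁`, `xₚ`. -/
noncomputable def calibrated (b : ℝ → ℝ) (x₁ xₚ : ℝ) (x : ℝ) : ℝ :=
  if x ≤ x₁ then b x else if x ≤ xₚ then x else b x - b xₚ + xₚ

/-! If all others follow a strictly increasing strategy vanishing at 0, ties have probability zero.
Contributing the equilibrium amount of type `s` then earns `R / K` times the probability `winProb`
that fewer than `K` of the `N - 1` others exceed `s`. The derivative of this prize is `c * β'(s) /
s`, so under `β` imitating `s` changes the utility of type `t` at a rate with the sign of `t - s`: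
only the budget constraint stands between `β` and equilibrium.

The density `β'` is strictly log-concave on `(0, 1)`. Rolle's theorem on `[0, x₁]` and `[x₁, x₂]`
gives points `ξ < x₁ < η` where it equals 1; hence it is below 1 before `ξ`, above 1 between, below
1 after `η`, and `xₚ = η`. So `β` is affordable up to `x₁`, and replacing its slope by 1 on `[x₁,
xₚ]` restores affordability beyond.

Calibration only lowers increments, so imitating a lower type stays unprofitable. A higher type can
be afforded only where the increments are unchanged. -/

/-! ### Binomial law of the number of stronger opponents -/

section Counting

/-- The possible sets of opponents falling in `A` partition the space into product boxes, on each of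
which the integrand is constant. -/
theorem integral_comp_filter_mem_pi {N : ℕ} (μ : Measure ℝ) [IsProbabilityMeasure μ] {A : Set ℝ}
    [DecidablePred (· ∈ A)] (hA : MeasurableSet A) (i : Fin N) (f : Finset (Fin N) → ℝ) :
    ∫ q : Fin N → ℝ, f ((Finset.univ.erase i).filter fun j => q j ∈ A)
        ∂(Measure.pi fun _ : Fin N => μ) =
      ∑ S ∈ (Finset.univ.erase i).powerset,
        f S * (μ.real A ^ S.card * μ.real Aᶜ ^ (N - 1 - S.card)) := by
  classical
  -- Coordinate `i` is left free: a user's own type does not count among her opponents.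
  let side : Finset (Fin N) → Fin N → Set ℝ := fun S j =>
    if j = i then univ else if j ∈ S then A else Aᶜ
  have hside : ∀ S j, MeasurableSet (side S j) := by
    intro S j
    simp only [side]
    split_ifs
    exacts [MeasurableSet.univ, hA, hA.compl]
  have hbox : ∀ S, MeasurableSet (Set.pi univ (side S)) := fun S =>
    MeasurableSet.univ_pi (hside S)
  have hmem : ∀ S ∈ (Finset.univ.erase i).powerset, ∀ q : Fin N → ℝ,
      q ∈ Set.pi univ (side S) ↔ ((Finset.univ.erase i).filter fun j => q j ∈ A) = S := by
    intro S hS q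
    rw [Finset.mem_powerset] at hS
    simp only [Set.mem_pi, mem_univ, true_implies, side]
    constructor
    · intro h
      ext j
      have hj := h j
      simp only [Finset.mem_filter, Finset.mem_erase, Finset.mem_univ, and_true]
      by_cases hji : j = i
      · subst hji
        simpa using fun hjS => (Finset.mem_erase.1 (hS hjS)).1 rfl
      · by_cases hjS : j ∈ S <;> simp_all
    · rintro rfl j
      by_cases hji : j = i
      · simp [hji]
      · by_cases hjA : q j ∈ A <;> simp [hji, hjA]
  have hsum : ∀ q : Fin N → ℝ, f ((Finset.univ.erase i).filter fun j => q j ∈ A) =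
      ∑ S ∈ (Finset.univ.erase i).powerset,
        (Set.pi univ (side S)).indicator (fun _ => f S) q := by
    intro q
    rw [Finset.sum_eq_single_of_mem ((Finset.univ.erase i).filter fun j => q j ∈ A)
      (Finset.mem_powerset.2 (Finset.filter_subset _ _))]
    · rw [Set.indicator_of_mem]
      exact (hmem _ (Finset.mem_powerset.2 (Finset.filter_subset _ _)) q).2 rfl
    · intro S hS hne
      rw [Set.indicator_of_notMem]
      exact fun h => hne ((hmem S hS q).1 h).symm
  simp_rw [hsum]
  rw [integral_finsetSum _ fun S _ => (integrable_const (f S)).indicator (hbox S)]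
  refine Finset.sum_congr rfl fun S hS => ?_
  rw [Finset.mem_powerset] at hS
  rw [integral_indicator_const _ (hbox S), smul_eq_mul, mul_comm]
  congr 1
  rw [measureReal_def, Measure.pi_pi, ENNReal.toReal_prod,
    ← Finset.mul_prod_erase Finset.univ _ (Finset.mem_univ i), ← Finset.prod_sdiff hS, mul_comm]
  have h1 : ∏ j ∈ S, (μ (side S j)).toReal = μ.real A ^ S.card := by
    rw [← Finset.prod_const]
    refine Finset.prod_congr rfl fun j hj => ?_
    simp [side, (Finset.mem_erase.1 (hS hj)).1, hj, measureReal_def]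
  have h2 : ∏ j ∈ Finset.univ.erase i \ S, (μ (side S j)).toReal =
      μ.real Aᶜ ^ (N - 1 - S.card) := by
    have hc : (Finset.univ.erase i \ S).card = N - 1 - S.card := by
      rw [Finset.card_sdiff_of_subset hS, Finset.card_erase_of_mem (Finset.mem_univ i),
        Finset.card_univ, Fintype.card_fin]
    rw [← hc, ← Finset.prod_const]
    refine Finset.prod_congr rfl fun j hj => ?_
    rw [Finset.mem_sdiff, Finset.mem_erase] at hj
    simp [side, hj.1.1, hj.2, measureReal_def]
  rw [h1, h2]
  simp [side, mul_comm]

/-- Probability that fewer than `K` of `n` independent uniform variables exceed `s`. -/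
noncomputable def winProb (n K : ℕ) (s : ℝ) : ℝ :=
  ∑ r ∈ Finset.range K, (n.choose r : ℝ) * ((1 - s) ^ r * s ^ (n - r))

theorem winProb_one {n K : ℕ} (hK : 1 ≤ K) : winProb n K 1 = 1 := by
  obtain ⟨k, rfl⟩ := Nat.exists_eq_add_of_le' hK
  simp [winProb, Finset.sum_range_succ']

theorem winProb_zero {n K : ℕ} (hK : K ≤ n) : winProb n K 0 = 0 := by
  refine Finset.sum_eq_zero fun r hr => ?_
  have : n - r ≠ 0 := by have := Finset.mem_range.1 hr; omega
  simp [this]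

/-- The derivative of a Bernstein polynomial is a multiple of a difference of two consecutive ones
of lower degree, so the sum telescopes. -/
theorem derivative_sum_bernsteinPolynomial (n k : ℕ) :
    Polynomial.derivative (∑ r ∈ Finset.range (k + 1), bernsteinPolynomial ℝ (n + 1) r) =
      -((n : Polynomial ℝ) + 1) * bernsteinPolynomial ℝ n k := by
  induction k with
  | zero => simp [bernsteinPolynomial.derivative_zero]
  | succ k ih =>
    rw [Finset.sum_range_succ, Polynomial.derivative_add, ih,
      bernsteinPolynomial.derivative_succ]
    push_cast [Nat.add_sub_cancel]
    ring

theorem winProb_eq_eval (n K : ℕ) (s : ℝ) :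
    winProb n K s = (∑ r ∈ Finset.range K, bernsteinPolynomial ℝ n r).eval (1 - s) := by
  simp [winProb, Polynomial.eval_finsetSum, bernsteinPolynomial, mul_assoc]

theorem hasDerivAt_winProb (n k : ℕ) (s : ℝ) :
    HasDerivAt (winProb (n + 1) (k + 1))
      ((n + 1) * (n.choose k : ℝ) * (s ^ (n - k) * (1 - s) ^ k)) s := by
  have h := ((∑ r ∈ Finset.range (k + 1), bernsteinPolynomial ℝ (n + 1) r).hasDerivAt
    (1 - s)).comp s ((hasDerivAt_id s).const_sub 1)
  rw [derivative_sum_bernsteinPolynomial] at h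
  refine (h.congr_deriv ?_).congr_of_eventuallyEq
    (Filter.Eventually.of_forall fun x => winProb_eq_eval _ _ _)
  simp [bernsteinPolynomial]
  ring

instance : IsProbabilityMeasure uniform01 := ⟨by simp [uniform01]⟩

theorem uniform01_real_Iic {s : ℝ} (hs : s ∈ Icc (0 : ℝ) 1) : uniform01.real (Iic s) = s := by
  have h : Iic s ∩ Icc 0 1 = Icc (0 : ℝ) s := by
    ext x
    simp only [mem_inter_iff, mem_Iic, mem_Icc]
    exact ⟨fun h => ⟨h.2.1, h.1⟩, fun h => ⟨h.2, h.1, h.2.trans hs.2⟩⟩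
  rw [uniform01, measureReal_restrict_apply measurableSet_Iic, h, Real.volume_real_Icc,
    sub_zero, max_eq_left hs.1]

theorem uniform01_real_Ioi {s : ℝ} (hs : s ∈ Icc (0 : ℝ) 1) :
    uniform01.real (Ioi s) = 1 - s := by
  rw [← compl_Iic, probReal_compl_eq_one_sub measurableSet_Iic, uniform01_real_Iic hs]

theorem integral_few_exceed {N K : ℕ} (hKN : K < N) (i : Fin N) {s : ℝ} (hs : s ∈ Icc (0 : ℝ) 1) :
    ∫ q : Fin N → ℝ,
        (if ((Finset.univ.erase i).filter fun j => s < q j).card < K then (1 : ℝ) else 0)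
        ∂(Measure.pi fun _ : Fin N => uniform01) = winProb (N - 1) K s := by
  classical
  have h := integral_comp_filter_mem_pi uniform01 (A := Ioi s) measurableSet_Ioi i
    (fun S => if S.card < K then (1 : ℝ) else 0)
  simp only [mem_Ioi, compl_Ioi, uniform01_real_Iic hs, uniform01_real_Ioi hs] at h
  rw [h, Finset.sum_powerset_apply_card
    (fun r => (if r < K then (1 : ℝ) else 0) * ((1 - s) ^ r * s ^ (N - 1 - r))),
    Finset.card_erase_of_mem (Finset.mem_univ i), Finset.card_univ, Fintype.card_fin, winProb]
  symm
  refine Finset.sum_subset_zero_on_sdiff (Finset.range_subset_range.2 (by omega)) ?_ ?_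
  · intro r hr
    simp only [Finset.mem_sdiff, Finset.mem_range] at hr
    simp [hr.2]
  · intro r hr
    simp [Finset.mem_range.1 hr]

end Counting

/-! ### Expected reward against a strictly increasing strategy -/

section Reward

theorem topKShare_le_one {N : ℕ} (K : ℕ) (x : Fin N → ℝ) (i : Fin N) : topKShare K x i ≤ 1 := by
  unfold topKShare
  split_ifs
  exacts [min_le_left _ _, zero_le_one]

theorem topKShare_nonneg {N : ℕ} (K : ℕ) (x : Fin N → ℝ) (i : Fin N) : 0 ≤ topKShare K x i := by
  unfold topKShare
  split_ifs
  · positivity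
  · rfl

theorem integral_topKReward_le {N K : ℕ} {R : ℝ} (hR : 0 < R) (μ : Measure ℝ)
    [IsProbabilityMeasure μ] (x : (Fin N → ℝ) → Fin N → ℝ) (i : Fin N) :
    ∫ q : Fin N → ℝ, topKReward K R (x q) i ∂(Measure.pi fun _ : Fin N => μ) ≤ R / K := by
  have h : ∀ q, ‖topKReward K R (x q) i‖ ≤ R / K := fun q => by
    have h0 := topKShare_nonneg K (x q) i
    rw [topKReward, Real.norm_of_nonneg (by positivity)]
    exact mul_le_of_le_one_right (by positivity) (topKShare_le_one _ _ _)
  simpa using (le_abs_self _).trans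
    (norm_integral_le_of_norm_le_const (μ := Measure.pi fun _ : Fin N => μ)
      (Filter.Eventually.of_forall h))

theorem ae_pi_uniform01 {N : ℕ} (s : ℝ) :
    ∀ᵐ q : Fin N → ℝ ∂(Measure.pi fun _ : Fin N => uniform01),
      ∀ j, q j ∈ Icc (0 : ℝ) 1 ∧ q j ≠ s := by
  rw [ae_all_iff]
  intro j
  have h : ∀ᵐ y ∂uniform01, y ∈ Icc (0 : ℝ) 1 ∧ y ≠ s :=
    (ae_restrict_mem measurableSet_Icc).and
      (ae_restrict_of_ae (by simp [ae_iff]))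
  exact (Measure.quasiMeasurePreserving_eval (μ := fun _ : Fin N => uniform01) j).ae h

theorem integral_topKReward_of_strictMonoOn {N K : ℕ} (hKN : K < N) (R : ℝ) {b : ℝ → ℝ}
    (hb : StrictMonoOn b (Icc 0 1)) (hb0 : b 0 = 0) (i : Fin N) {s : ℝ}
    (hs : s ∈ Icc (0 : ℝ) 1) :
    ∫ q : Fin N → ℝ, topKReward K R (Function.update (fun j => b (q j)) i (b s)) i
        ∂(Measure.pi fun _ : Fin N => uniform01) = R / K * winProb (N - 1) K s := by
  rcases hs.1.eq_or_lt with rfl | hs0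
  -- A zero contribution is never rewarded; `winProb` agrees because `K ≤ N - 1`.
  · rw [winProb_zero (by omega)]
    simp [topKReward, topKShare, hb0]
  · have hpos : 0 < b s := hb0 ▸ hb ⟨le_rfl, zero_le_one⟩ hs hs0
    rw [← integral_few_exceed hKN i hs, ← integral_const_mul]
    -- Almost surely no type equals `s`, so by injectivity user `i` is tied only with herself.
    refine integral_congr_ae ((ae_pi_uniform01 s).mono fun q hq => ?_)
    have h1 : (Finset.univ.filter fun j =>
        b s < Function.update (fun j => b (q j)) i (b s) j) =
        (Finset.univ.erase i).filter fun j => s < q j := by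
      ext j
      by_cases hj : j = i
      · simp [hj]
      · simp [hj, hb.lt_iff_lt hs (hq j).1]
    have h2 : (Finset.univ.filter fun j =>
        Function.update (fun j => b (q j)) i (b s) j = b s) = {i} := by
      ext j
      by_cases hj : j = i
      · simp [hj]
      · simpa [hj] using fun h => (hq j).2 (hb.injOn (hq j).1 hs h)
    simp only [topKReward, topKShare, Function.update_self, h1, h2, if_pos hpos,
      Finset.card_singleton, Nat.cast_one, div_one]
    congr 1
    split_ifs with h
    · exact min_eq_left (by exact_mod_cast Nat.sub_pos_of_lt h)
    · simp [Nat.sub_eq_zero_of_le (not_lt.1 h)]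

end Reward

/-! ### Log-concavity of the density -/

section Rate

/-- The density `A t ^ (m + 1) (1 - t) ^ l` of the uncalibrated strategy. -/
noncomputable def rate (A : ℝ) (m l : ℕ) (t : ℝ) : ℝ := A * (t ^ (m + 1) * (1 - t) ^ l)

theorem continuous_rate (A : ℝ) (m l : ℕ) : Continuous (rate A m l) := by
  unfold rate
  fun_prop

theorem rate_pos {A : ℝ} (hA : 0 < A) (m l : ℕ) {t : ℝ} (ht : t ∈ Ioo (0 : ℝ) 1) :
    0 < rate A m l t := by
  have := ht.1
  have := sub_pos.2 ht.2
  unfold rate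
  positivity

/-- The exponent `m + 1` always leaves one full `log t`, which makes the concavity strict even when
`m = l = 0`. -/
theorem strictConcaveOn_log_rate {A : ℝ} (hA : 0 < A) (m l : ℕ) :
    StrictConcaveOn ℝ (Ioo 0 1) fun t => Real.log (rate A m l t) := by
  have hsub : Ioo (0 : ℝ) 1 ⊆ Ioi 0 := fun t ht => ht.1
  have hlog := strictConcaveOn_log_Ioi.subset hsub (convex_Ioo 0 1)
  have hm : ConcaveOn ℝ (Ioo (0 : ℝ) 1) fun t => (m : ℝ) * Real.log t :=
    hlog.concaveOn.smul (Nat.cast_nonneg m)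
  have hl : ConcaveOn ℝ (Ioo (0 : ℝ) 1) fun t => (l : ℝ) * Real.log (1 - t) := by
    refine ConcaveOn.smul (Nat.cast_nonneg l) ⟨convex_Ioo 0 1, fun x hx y hy a b ha hb hab => ?_⟩
    have := strictConcaveOn_log_Ioi.concaveOn.2 (x := 1 - x) (sub_pos.2 hx.2)
      (y := 1 - y) (sub_pos.2 hy.2) ha hb hab
    convert this using 2
    simp only [smul_eq_mul]
    linear_combination -hab
  refine ((hlog.add_concaveOn (hm.add hl)).add_concaveOn
    (concaveOn_const (Real.log A) (convex_Ioo 0 1))).congr fun t ht => ?_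
  have h0 := ht.1
  have h1 := sub_pos.2 ht.2
  simp only [Pi.add_apply, rate]
  rw [Real.log_mul hA.ne' (by positivity), Real.log_mul (by positivity) (by positivity),
    Real.log_pow, Real.log_pow]
  push_cast
  ring

/-- A strictly concave logarithm vanishing at two points is positive between them and negative
outside; this and the next two lemmas compare its adjacent slopes. -/
theorem rate_between {A : ℝ} (hA : 0 < A) {m l : ℕ} {x y z : ℝ} (hx : 0 < x) (hxy : x < y)
    (hyz : y < z) (hz : z < 1) (h₁ : rate A m l x = 1) (h₂ : rate A m l z = 1) :
    1 < rate A m l y := by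
  have h := (strictConcaveOn_log_rate hA m l).slope_anti_adjacent
    ⟨hx, by linarith⟩ ⟨by linarith, hz⟩ hxy hyz
  simp only [h₁, h₂, Real.log_one, zero_sub, sub_zero] at h
  refine (Real.log_pos_iff (rate_pos hA m l ⟨by linarith, by linarith⟩).le).1 ?_
  by_contra! hle
  have := div_nonneg (neg_nonneg.2 hle) (sub_pos.2 hyz).le
  have := div_nonpos_of_nonpos_of_nonneg hle (sub_pos.2 hxy).le
  linarith

theorem rate_after {A : ℝ} (hA : 0 < A) {m l : ℕ} {x y z : ℝ} (hx : 0 < x) (hxy : x < y)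
    (hyz : y < z) (hz : z < 1) (h₁ : rate A m l x = 1) (h₂ : rate A m l y = 1) :
    rate A m l z < 1 := by
  by_contra! hle
  have h := (strictConcaveOn_log_rate hA m l).slope_anti_adjacent
    ⟨hx, by linarith⟩ ⟨by linarith, hz⟩ hxy hyz
  simp only [h₁, h₂, Real.log_one, sub_zero, zero_div] at h
  exact h.not_ge (div_nonneg (Real.log_nonneg hle) (sub_pos.2 hyz).le)

theorem rate_before {A : ℝ} (hA : 0 < A) {m l : ℕ} {x y z : ℝ} (hx : 0 < x) (hxy : x < y)
    (hyz : y < z) (hz : z < 1) (h₁ : rate A m l y = 1) (h₂ : rate A m l z = 1) :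
    rate A m l x < 1 := by
  by_contra! hle
  have h := (strictConcaveOn_log_rate hA m l).slope_anti_adjacent
    ⟨hx, by linarith⟩ ⟨by linarith, hz⟩ hxy hyz
  simp only [h₁, h₂, Real.log_one, zero_sub, sub_zero, zero_div] at h
  exact h.not_ge (div_nonpos_of_nonpos_of_nonneg (neg_nonpos.2 (Real.log_nonneg hle))
    (sub_pos.2 hxy).le)

end Rate

/-! ### The uncalibrated strategy as a primitive -/

section Uncalibrated

theorem cdf_uniform01 {t : ℝ} (ht : t ∈ Icc (0 : ℝ) 1) : ProbabilityTheory.cdf uniform01 t = t := by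
  rw [ProbabilityTheory.cdf_eq_real, uniform01_real_Iic ht]

/-- The multiplicative constant of the uncalibrated strategy. -/
noncomputable def prizeScale (N K : ℕ) (R c : ℝ) : ℝ :=
  R * ((N : ℝ) - 1) / (c * K) * ((N - 2).choose (K - 1) : ℝ)

theorem prizeScale_pos {N K : ℕ} (hK : 1 ≤ K) (hKN : K < N) {R c : ℝ} (hR : 0 < R)
    (hc : 0 < c) : 0 < prizeScale N K R c := by
  have h1 : (0 : ℝ) < (N : ℝ) - 1 := sub_pos.2 (by exact_mod_cast (by omega : 1 < N))
  have h2 : 0 < (N - 2).choose (K - 1) := Nat.choose_pos (by omega)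
  unfold prizeScale
  positivity

theorem uncalibrated_uniform01 (N K : ℕ) (R c x : ℝ) :
    uncalibrated N K R c uniform01 x =
      ∫ t in (0 : ℝ)..max 0 (min x 1), rate (prizeScale N K R c) (N - K - 1) (K - 1) t := by
  have hset : (∫ t in Icc 0 x, t * ProbabilityTheory.cdf uniform01 t ^ (N - K - 1) *
      (1 - ProbabilityTheory.cdf uniform01 t) ^ (K - 1) ∂uniform01) =
      ∫ t in Ioc 0 (max 0 (min x 1)), t ^ (N - K - 1 + 1) * (1 - t) ^ (K - 1) := by
    have hI : Icc 0 x ∩ Icc 0 1 = Icc 0 (min x 1) := by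
      simp [Icc_inter_Icc]
    rw [uniform01, Measure.restrict_restrict measurableSet_Icc, hI, ← uniform01,
      integral_Icc_eq_integral_Ioc]
    have hJ : Ioc 0 (max 0 (min x 1)) = Ioc 0 (min x 1) := by
      rcases le_total 0 (min x 1) with h | h
      · rw [max_eq_right h]
      · rw [max_eq_left h, Ioc_self, Ioc_eq_empty (not_lt.2 h)]
    rw [hJ]
    refine setIntegral_congr_fun measurableSet_Ioc fun t ht => ?_
    simp only [cdf_uniform01 ⟨ht.1.le, ht.2.trans (min_le_right _ _)⟩]
    ring
  rw [uncalibrated, hset, intervalIntegral.integral_of_le (le_max_left _ _), prizeScale,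
    ← integral_const_mul]
  rfl

variable (N K : ℕ) (R c : ℝ)

theorem continuous_uncalibrated_uniform01 : Continuous (uncalibrated N K R c uniform01) := by
  simp_rw [funext (uncalibrated_uniform01 N K R c)]
  exact (intervalIntegral.continuous_primitive
    (fun a b => (continuous_rate _ _ _).intervalIntegrable a b) 0).comp (by fun_prop)

theorem uncalibrated_uniform01_zero : uncalibrated N K R c uniform01 0 = 0 := by
  simp [uncalibrated_uniform01]

theorem hasDerivAt_uncalibrated_uniform01 {x : ℝ} (hx : x ∈ Ioo (0 : ℝ) 1) :
    HasDerivAt (uncalibrated N K R c uniform01)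
      (rate (prizeScale N K R c) (N - K - 1) (K - 1) x) x := by
  have hcont := continuous_rate (prizeScale N K R c) (N - K - 1) (K - 1)
  refine (intervalIntegral.integral_hasDerivAt_right (hcont.intervalIntegrable 0 x)
    hcont.stronglyMeasurable.stronglyMeasurableAtFilter
    hcont.continuousAt).congr_of_eventuallyEq ?_
  filter_upwards [Ioo_mem_nhds hx.1 hx.2] with y hy
  rw [uncalibrated_uniform01, min_eq_left hy.2.le, max_eq_right hy.1.le]

/-- The measure has no mass beyond 1, so the right derivative there is 0. This forces the tangency
point into the open interval. -/
theorem not_hasDerivAt_uncalibrated_uniform01_one :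
    ¬ HasDerivAt (uncalibrated N K R c uniform01) 1 1 := by
  intro h
  have h0 : HasDerivWithinAt (uncalibrated N K R c uniform01) 0 (Ici 1) 1 := by
    refine (hasDerivWithinAt_const (1 : ℝ) (Ici 1)
      (uncalibrated N K R c uniform01 1)).congr (fun y hy => ?_) rfl
    rw [uncalibrated_uniform01, uncalibrated_uniform01, min_eq_right (mem_Ici.1 hy), min_self]
  exact one_ne_zero ((uniqueDiffOn_Ici (1 : ℝ) 1 self_mem_Ici).eq_deriv _ h.hasDerivWithinAt h0)

end Uncalibrated

/-! ### Monotonicity, feasibility and deviations after calibration -/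

section Calibrated

variable {β : ℝ → ℝ} {x₁ xₚ : ℝ}

theorem continuous_calibrated (hβ : Continuous β) (hlt : x₁ < xₚ) (hroot : β x₁ = x₁) :
    Continuous (calibrated β x₁ xₚ) := by
  unfold calibrated
  refine Continuous.if_le hβ ?_ continuous_id continuous_const ?_
  · refine Continuous.if_le continuous_id (by fun_prop) continuous_id continuous_const ?_
    rintro x rfl
    ring
  · rintro x rfl
    rw [if_pos hlt.le, hroot]

theorem strictMonoOn_calibrated (h₁ : 0 < x₁) (hlt : x₁ < xₚ) (hp : xₚ ≤ 1)
    (hroot : β x₁ = x₁) (hmono : StrictMonoOn β (Icc 0 1)) :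
    StrictMonoOn (calibrated β x₁ xₚ) (Icc 0 1) := by
  intro x hx y hy hxy
  have hβ := hmono hx hy hxy
  have hβ₁ : x ≤ x₁ → β x ≤ x₁ := fun h =>
    hroot ▸ hmono.monotoneOn hx ⟨h₁.le, by linarith⟩ h
  have hβₚ : xₚ < y → β xₚ < β y := fun h => hmono ⟨by linarith, hp⟩ hy h
  unfold calibrated
  split_ifs with a b c d e f
  all_goals first
    | linarith
    | linarith [hβ₁ a]
    | (have := hβ₁ a; have := hβₚ (not_le.1 c); linarith)
    | (have := hβₚ (not_le.1 (by assumption)); linarith)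

/-- Slopes differ only on `[x₁, xₚ]`, where `hmid` says that `β` grows at least as fast as the
identity. -/
theorem calibrated_sub_le (hlt : x₁ < xₚ) (hroot : β x₁ = x₁)
    (hmid : MonotoneOn (fun x => β x - x) (Icc x₁ xₚ)) {s t : ℝ} (hst : s ≤ t) :
    calibrated β x₁ xₚ t - calibrated β x₁ xₚ s ≤ β t - β s := by
  have hx : ∀ x y, x₁ ≤ x → x ≤ y → y ≤ xₚ → β x - x ≤ β y - y := fun x y h h' h'' =>
    hmid ⟨h, h'.trans h''⟩ ⟨h.trans h', h''⟩ h'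
  unfold calibrated
  split_ifs with a b c d e f
  all_goals first
    | linarith
    | linarith [hx s t (not_le.1 ‹_›).le hst ‹_›]
    | linarith [hx x₁ t le_rfl (not_le.1 ‹_›).le ‹_›]
    | linarith [hx x₁ xₚ le_rfl hlt.le le_rfl]
    | linarith [hx s xₚ (not_le.1 ‹_›).le ‹_› le_rfl]

theorem calibrated_mem_Icc (h₁ : 0 < x₁) (hlt : x₁ < xₚ) (hp : xₚ ≤ 1) (hzero : β 0 = 0)
    (hroot : β x₁ = x₁) (hmono : StrictMonoOn β (Icc 0 1)) (hle : ∀ x ∈ Icc 0 x₁, β x ≤ x)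
    (hright : AntitoneOn (fun x => β x - x) (Icc xₚ 1)) {t : ℝ} (ht : t ∈ Icc (0 : ℝ) 1) :
    calibrated β x₁ xₚ t ∈ Icc 0 t := by
  have h0 : calibrated β x₁ xₚ 0 = 0 := by simp [calibrated, h₁.le, hzero]
  refine ⟨h0 ▸ (strictMonoOn_calibrated h₁ hlt hp hroot hmono).monotoneOn
    ⟨le_rfl, zero_le_one⟩ ht ht.1, ?_⟩
  unfold calibrated
  split_ifs with a b
  · exact hle t ⟨ht.1, a⟩
  · exact le_rfl
  · have := hright ⟨le_rfl, hp⟩ ⟨(not_le.1 b).le, ht.2⟩ (not_le.1 b).le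
    simp only at this
    linarith

/-- No type gains by imitating another type whose contribution she can afford. -/
theorem calibrated_deviation_le {c : ℝ} {Q : ℝ → ℝ} (hc : 0 < c) (h₁ : 0 < x₁) (hlt : x₁ < xₚ)
    (hroot : β x₁ = x₁)
    (hmid : MonotoneOn (fun x => β x - x) (Icc x₁ xₚ))
    {t : ℝ} (ht : t ∈ Ioc (0 : ℝ) 1)
    (hup : MonotoneOn (fun s => Q s - c * (β s / t)) (Icc 0 t))
    (hdown : AntitoneOn (fun s => Q s - c * (β s / t)) (Icc t 1))
    {s : ℝ} (hs : s ∈ Icc (0 : ℝ) 1) (hst : calibrated β x₁ xₚ s ≤ t)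
    (hmono : StrictMonoOn (calibrated β x₁ xₚ) (Icc 0 1)) :
    Q s - c * (calibrated β x₁ xₚ s / t) ≤ Q t - c * (calibrated β x₁ xₚ t / t) := by
  -- Incentives hold for the costs of `β`; it remains to compare cost increments.
  suffices h : ∃ d, d = calibrated β x₁ xₚ t - calibrated β x₁ xₚ s ∧
      Q s - c * (β s / t) ≤ Q t - c * (β t / t) ∧ d ≤ β t - β s by
    obtain ⟨d, rfl, hQ, hd⟩ := h
    have : c * ((calibrated β x₁ xₚ t - calibrated β x₁ xₚ s) / t) ≤ c * ((β t - β s) / t) := by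
      have := ht.1
      gcongr
    rw [sub_div, sub_div, mul_sub, mul_sub] at this
    linarith
  refine ⟨_, rfl, ?_⟩
  rcases le_total s t with h | h
  · exact ⟨hup ⟨hs.1, h⟩ ⟨ht.1.le, le_rfl⟩ h, calibrated_sub_le hlt hroot hmid h⟩
  · refine ⟨hdown ⟨le_rfl, ht.2⟩ ⟨h, hs.2⟩ h, ?_⟩
    rcases h.eq_or_lt with rfl | hlt'
    · simp
    have hmono_ts := hmono ⟨ht.1.le, ht.2⟩ hs hlt'
    have h₁s : x₁ < s → x₁ < calibrated β x₁ xₚ s := fun h' => by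
      have := hmono ⟨h₁.le, h'.le.trans hs.2⟩ hs h'
      rwa [calibrated, if_pos le_rfl, hroot] at this
    -- For `t` in `(x₁, xₚ]` the whole budget is already spent, and for `t ≤ x₁ < s` the
    -- contribution of `s` exceeds `x₁`. Otherwise both types lie on the same translate of `β`.
    have key : s ≤ x₁ ∨ xₚ < t := by
      by_contra! hcon
      have hx := h₁s hcon.1
      have : calibrated β x₁ xₚ t = t := by
        rw [calibrated, if_neg (by linarith), if_pos hcon.2]
      linarith
    rcases key with hk | hk
    · simp [calibrated, hk, h.trans hk]
    · have e1 : ¬ t ≤ x₁ := by linarith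
      have e2 : ¬ s ≤ x₁ := by linarith
      have e3 : ¬ t ≤ xₚ := by linarith
      have e4 : ¬ s ≤ xₚ := by linarith
      simp [calibrated, e1, e2, e3, e4]

end Calibrated

/-! ### First-order condition and equilibrium -/

section Equilibrium

variable {N K : ℕ} {R c : ℝ}

theorem hasDerivAt_prize (hK : 1 ≤ K) (hKN : K < N) (hc : 0 < c) (s : ℝ) :
    HasDerivAt (fun s => R / K * winProb (N - 1) K s)
      (c * (prizeScale N K R c * (s ^ (N - K - 1) * (1 - s) ^ (K - 1)))) s := by
  obtain ⟨k, rfl⟩ := Nat.exists_eq_add_of_le' hK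
  obtain ⟨n, rfl⟩ : ∃ n, N = n + 2 := Nat.exists_eq_add_of_le' (by omega)
  refine ((hasDerivAt_winProb n k s).const_mul (R / ((k + 1 : ℕ) : ℝ))).congr_deriv ?_
  have e : n + 2 - (k + 1) - 1 = n - k := by omega
  simp only [prizeScale, Nat.add_sub_cancel, e]
  push_cast
  field_simp
  ring

/-- The density of `β` is `s` times that of the prize divided by `c`, which leaves the factor `1 - s
/ t`. -/
theorem hasDerivAt_imitation (hK : 1 ≤ K) (hKN : K < N) (hc : 0 < c) {s t : ℝ}
    (hs : s ∈ Ioo (0 : ℝ) 1) (ht : 0 < t) :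
    HasDerivAt (fun s => R / K * winProb (N - 1) K s - c * (uncalibrated N K R c uniform01 s / t))
      (c * (prizeScale N K R c * (s ^ (N - K - 1) * (1 - s) ^ (K - 1))) * ((t - s) / t)) s := by
  refine ((hasDerivAt_prize hK hKN hc s).sub
    (((hasDerivAt_uncalibrated_uniform01 N K R c hs).div_const t).const_mul c)).congr_deriv ?_
  unfold rate
  field_simp
  ring

theorem continuous_imitation (t : ℝ) :
    Continuous fun s =>
      R / K * winProb (N - 1) K s - c * (uncalibrated N K R c uniform01 s / t) := by
  have := continuous_uncalibrated_uniform01 N K R c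
  unfold winProb
  fun_prop

theorem monotoneOn_imitation (hK : 1 ≤ K) (hKN : K < N) (hR : 0 < R) (hc : 0 < c) {t : ℝ}
    (ht : t ∈ Ioc (0 : ℝ) 1) :
    MonotoneOn (fun s => R / K * winProb (N - 1) K s -
      c * (uncalibrated N K R c uniform01 s / t)) (Icc 0 t) := by
  have hA := prizeScale_pos hK hKN hR hc
  refine monotoneOn_of_hasDerivWithinAt_nonneg (convex_Icc 0 t)
    (f' := fun s =>
      c * (prizeScale N K R c * (s ^ (N - K - 1) * (1 - s) ^ (K - 1))) * ((t - s) / t))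
    (continuous_imitation t).continuousOn (fun s hs => ?_) fun s hs => ?_
  all_goals rw [interior_Icc] at hs
  · exact (hasDerivAt_imitation hK hKN hc ⟨hs.1, hs.2.trans_le ht.2⟩ ht.1).hasDerivWithinAt
  · have h0 := hs.1
    have h1 : 0 < 1 - s := sub_pos.2 (hs.2.trans_le ht.2)
    have h2 := sub_pos.2 hs.2
    have h3 := ht.1
    positivity

theorem antitoneOn_imitation (hK : 1 ≤ K) (hKN : K < N) (hR : 0 < R) (hc : 0 < c) {t : ℝ}
    (ht : t ∈ Ioc (0 : ℝ) 1) :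
    AntitoneOn (fun s => R / K * winProb (N - 1) K s -
      c * (uncalibrated N K R c uniform01 s / t)) (Icc t 1) := by
  have hA := prizeScale_pos hK hKN hR hc
  refine antitoneOn_of_hasDerivWithinAt_nonpos (convex_Icc t 1)
    (f' := fun s =>
      c * (prizeScale N K R c * (s ^ (N - K - 1) * (1 - s) ^ (K - 1))) * ((t - s) / t))
    (continuous_imitation t).continuousOn (fun s hs => ?_) fun s hs => ?_
  all_goals rw [interior_Icc] at hs
  · exact (hasDerivAt_imitation hK hKN hc ⟨ht.1.trans hs.1, hs.2⟩ ht.1).hasDerivWithinAt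
  · have h0 := ht.1.trans hs.1
    have h1 : 0 < 1 - s := sub_pos.2 hs.2
    exact mul_nonpos_of_nonneg_of_nonpos (by positivity)
      (div_nonpos_of_nonpos_of_nonneg (sub_nonpos.2 hs.1.le) ht.1.le)

theorem strictMonoOn_uncalibrated_uniform01 (hK : 1 ≤ K) (hKN : K < N) (hR : 0 < R)
    (hc : 0 < c) : StrictMonoOn (uncalibrated N K R c uniform01) (Icc 0 1) := by
  refine strictMonoOn_of_deriv_pos (convex_Icc 0 1)
    (continuous_uncalibrated_uniform01 N K R c).continuousOn fun x hx => ?_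
  rw [interior_Icc] at hx
  rw [(hasDerivAt_uncalibrated_uniform01 N K R c hx).deriv]
  exact rate_pos (prizeScale_pos hK hKN hR hc) _ _ hx

theorem hasDerivAt_uncalibrated_sub_id {x : ℝ} (hx : x ∈ Ioo (0 : ℝ) 1) :
    HasDerivAt (fun x => uncalibrated N K R c uniform01 x - x)
      (rate (prizeScale N K R c) (N - K - 1) (K - 1) x - 1) x :=
  (hasDerivAt_uncalibrated_uniform01 N K R c hx).sub (hasDerivAt_id x)

theorem continuous_uncalibrated_sub_id :
    Continuous fun x => uncalibrated N K R c uniform01 x - x :=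
  (continuous_uncalibrated_uniform01 N K R c).sub continuous_id

theorem monotoneOn_uncalibrated_sub_id {a b : ℝ} (ha : 0 ≤ a) (hb : b ≤ 1)
    (h : ∀ x ∈ Ioo a b, 1 ≤ rate (prizeScale N K R c) (N - K - 1) (K - 1) x) :
    MonotoneOn (fun x => uncalibrated N K R c uniform01 x - x) (Icc a b) := by
  refine monotoneOn_of_hasDerivWithinAt_nonneg (convex_Icc a b)
    (f' := fun x => rate (prizeScale N K R c) (N - K - 1) (K - 1) x - 1)
    continuous_uncalibrated_sub_id.continuousOn (fun x hx => ?_) fun x hx => ?_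
  all_goals rw [interior_Icc] at hx
  · exact (hasDerivAt_uncalibrated_sub_id
      ⟨ha.trans_lt hx.1, hx.2.trans_le hb⟩).hasDerivWithinAt
  · exact sub_nonneg.2 (h x hx)

theorem antitoneOn_uncalibrated_sub_id {a b : ℝ} (ha : 0 ≤ a) (hb : b ≤ 1)
    (h : ∀ x ∈ Ioo a b, rate (prizeScale N K R c) (N - K - 1) (K - 1) x ≤ 1) :
    AntitoneOn (fun x => uncalibrated N K R c uniform01 x - x) (Icc a b) := by
  refine antitoneOn_of_hasDerivWithinAt_nonpos (convex_Icc a b)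
    (f' := fun x => rate (prizeScale N K R c) (N - K - 1) (K - 1) x - 1)
    continuous_uncalibrated_sub_id.continuousOn (fun x hx => ?_) fun x hx => ?_
  all_goals rw [interior_Icc] at hx
  · exact (hasDerivAt_uncalibrated_sub_id
      ⟨ha.trans_lt hx.1, hx.2.trans_le hb⟩).hasDerivWithinAt
  · exact sub_nonpos.2 (h x hx)

theorem exists_rate_eq_one {a b : ℝ} (ha : 0 ≤ a) (hab : a < b) (hb : b ≤ 1)
    (hra : uncalibrated N K R c uniform01 a = a) (hrb : uncalibrated N K R c uniform01 b = b) :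
    ∃ x ∈ Ioo a b, rate (prizeScale N K R c) (N - K - 1) (K - 1) x = 1 := by
  obtain ⟨x, hx, h⟩ := exists_hasDerivAt_eq_zero hab
    (continuous_uncalibrated_sub_id (N := N) (K := K) (R := R) (c := c)).continuousOn
    (by simp [hra, hrb])
    fun x hx => hasDerivAt_uncalibrated_sub_id ⟨ha.trans_lt hx.1, hx.2.trans_le hb⟩
  exact ⟨x, hx, sub_eq_zero.1 h⟩

theorem isSymmetricEquilibrium_calibrated (hK : 1 ≤ K) (hKN : K < N) (hR : 0 < R) (hc : 0 < c)
    {x₁ xₚ : ℝ} (h₁ : 0 < x₁) (hlt : x₁ < xₚ) (hp : xₚ ≤ 1)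
    (hroot : uncalibrated N K R c uniform01 x₁ = x₁)
    (hle : ∀ x ∈ Icc 0 x₁, uncalibrated N K R c uniform01 x ≤ x)
    (hmid : MonotoneOn (fun x => uncalibrated N K R c uniform01 x - x) (Icc x₁ xₚ))
    (hright : AntitoneOn (fun x => uncalibrated N K R c uniform01 x - x) (Icc xₚ 1)) :
    IsSymmetricEquilibrium N K R c uniform01
      (calibrated (uncalibrated N K R c uniform01) x₁ xₚ) := by
  have hzero := uncalibrated_uniform01_zero N K R c
  have hβmono := strictMonoOn_uncalibrated_uniform01 hK hKN hR hc
  have hcont := continuous_calibrated (continuous_uncalibrated_uniform01 N K R c) hlt hroot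
  have hmono := strictMonoOn_calibrated h₁ hlt hp hroot hβmono
  have hfeas := fun t => calibrated_mem_Icc h₁ hlt hp hzero hroot hβmono hle hright (t := t)
  have hdev := fun t => calibrated_deviation_le (c := c)
    (Q := fun s => R / K * winProb (N - 1) K s) hc h₁ hlt hroot hmid (t := t)
  have hb0 : calibrated (uncalibrated N K R c uniform01) x₁ xₚ 0 = 0 := by
    simp [calibrated, h₁.le, hzero]
  set b := calibrated (uncalibrated N K R c uniform01) x₁ xₚ
  have hU : ∀ (i : Fin N) (t : ℝ), ∀ s ∈ Icc (0 : ℝ) 1,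
      interimUtility K R c uniform01 (fun _ => b) i (b s) t =
        R / K * winProb (N - 1) K s - c * (b s / t) := fun i t s hs => by
    rw [interimUtility, integral_topKReward_of_strictMonoOn hKN R hmono hb0 i hs]
  refine ⟨fun _ => hcont.measurable, fun _ t ht => hfeas t ht, fun i t ht a ha => ?_⟩
  rcases ht.1.eq_or_lt with rfl | ht0
  · rw [le_antisymm ha.2 ha.1, hb0]
  have ht' : t ∈ Ioc (0 : ℝ) 1 := ⟨ht0, ht.2⟩
  have key : ∀ s ∈ Icc (0 : ℝ) 1, b s ≤ t →
      R / K * winProb (N - 1) K s - c * (b s / t) ≤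
        interimUtility K R c uniform01 (fun _ => b) i (b t) t := fun s hs hst => by
    rw [hU i t t ht]
    exact hdev t ht' (monotoneOn_imitation hK hKN hR hc ht')
      (antitoneOn_imitation hK hKN hR hc ht') hs hst hmono
  -- By continuity every contribution up to `b 1` imitates some type; a larger one costs more than
  -- `b 1`, which already secures the maximal reward `R / K`.
  rcases le_or_gt a (b 1) with hab | hab
  · obtain ⟨s, hs, rfl⟩ := intermediate_value_Icc zero_le_one hcont.continuousOn
      (show a ∈ Icc (b 0) (b 1) from ⟨hb0.symm ▸ ha.1, hab⟩)
    rw [hU i t s hs]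
    exact key s hs ha.2
  · refine le_trans ?_ (key 1 ⟨zero_le_one, le_rfl⟩ (hab.le.trans ha.2))
    rw [winProb_one hK, mul_one, interimUtility]
    gcongr
    exact integral_topKReward_le hR uniform01 _ i

end Equilibrium

/-! ### The tangency point and the conclusion -/

theorem mainTheorem4 (N K : ℕ) (hK : 1 ≤ K) (hKN : K < N) (R c : ℝ) (hR : 0 < R) (hc : 0 < c)
    (x₁ x₂ : ℝ) (hx₁ : x₁ ∈ Set.Ioc (0 : ℝ) 1) (hx₂ : x₂ ∈ Set.Ioc (0 : ℝ) 1) (hlt : x₁ < x₂)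
    (hroot₁ : uncalibrated N K R c uniform01 x₁ = x₁)
    (hroot₂ : uncalibrated N K R c uniform01 x₂ = x₂) :
    (∃! xₚ : ℝ, xₚ ∈ Set.Ioc x₁ 1 ∧ HasDerivAt (uncalibrated N K R c uniform01) 1 xₚ) ∧
    ∀ xₚ ∈ Set.Ioc x₁ 1, HasDerivAt (uncalibrated N K R c uniform01) 1 xₚ →
      IsSymmetricEquilibrium N K R c uniform01
        (calibrated (uncalibrated N K R c uniform01) x₁ xₚ) := by
  have hA := prizeScale_pos hK hKN hR hc
  have hzero := uncalibrated_uniform01_zero N K R c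
  obtain ⟨ξ, hξ, hξ1⟩ := exists_rate_eq_one le_rfl hx₁.1 hx₁.2 hzero hroot₁
  obtain ⟨η, hη, hη1⟩ := exists_rate_eq_one hx₁.1.le hlt hx₂.2 hroot₁ hroot₂
  have hη_lt : η < 1 := hη.2.trans_le hx₂.2
  have hη_pos : 0 < η := hx₁.1.trans hη.1
  have hrate : ∀ x ∈ Ioc x₁ 1, HasDerivAt (uncalibrated N K R c uniform01) 1 x →
      x < 1 ∧ rate (prizeScale N K R c) (N - K - 1) (K - 1) x = 1 := by
    intro x hx h
    have hx1 : x < 1 := hx.2.lt_of_ne fun he =>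
      not_hasDerivAt_uncalibrated_uniform01_one N K R c (he ▸ h)
    exact ⟨hx1,
      (hasDerivAt_uncalibrated_uniform01 N K R c ⟨hx₁.1.trans hx.1, hx1⟩).unique h⟩
  refine ⟨⟨η, ⟨⟨hη.1, hη_lt.le⟩, ?_⟩, ?_⟩, ?_⟩
  · exact hη1 ▸ hasDerivAt_uncalibrated_uniform01 N K R c ⟨hη_pos, hη_lt⟩
  · rintro x ⟨hx, hderiv⟩
    obtain ⟨hx1, hrx⟩ := hrate x hx hderiv
    rcases lt_trichotomy x η with h | h | h
    · exact absurd hrx (rate_between hA hξ.1 (hξ.2.trans hx.1) h hη_lt hξ1 hη1).ne'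
    · exact h
    · exact absurd hrx (rate_after hA hξ.1 (hξ.2.trans hη.1) h hx1 hξ1 hη1).ne
  · intro xₚ hp hderiv
    obtain ⟨hp1, hrp⟩ := hrate xₚ hp hderiv
    have hξp : ξ < xₚ := hξ.2.trans hp.1
    have hmid := monotoneOn_uncalibrated_sub_id hξ.1.le hp.2 fun x hx =>
      (rate_between hA hξ.1 hx.1 hx.2 hp1 hξ1 hrp).le
    have hleft := antitoneOn_uncalibrated_sub_id le_rfl (hξp.trans hp1).le fun x hx =>
      (rate_before hA hx.1 hx.2 hξp hp1 hξ1 hrp).le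
    have hright := antitoneOn_uncalibrated_sub_id (hx₁.1.trans hp.1).le le_rfl fun x hx =>
      (rate_after hA hξ.1 hξp hx.1 hx.2 hξ1 hrp).le
    refine isSymmetricEquilibrium_calibrated hK hKN hR hc hx₁.1 hp.1 hp.2 hroot₁
      (fun x hx => sub_nonpos.1 ?_) (hmid.mono (Icc_subset_Icc_left hξ.2.le)) hright
    -- On `[0, x₁]` the difference `β x - x` falls from 0 until `ξ`, then rises back to 0 at `x₁`.
    rcases le_total x ξ with h | h
    · simpa [hzero] using hleft ⟨le_rfl, hξ.1.le⟩ ⟨hx.1, h⟩ hx.1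
    · simpa [hroot₁] using hmid ⟨h, hx.2.trans hp.1.le⟩ ⟨hξ.2.le, hp.1.le⟩ hx.2
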